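/- Let $m\ge 4$. Equip $\mathbb{C}^{2m}$, with standard basis $e_1,\dots,e_{2m}$, with the symmetric bilinear form $(e_i,e_j)=\delta_{i,2m+1-j}$, and let $\mathfrak{so}_{2m}$ be the Lie algebra of matrices that are skew-adjoint for this form. Identify $\bigwedge^2\mathbb{C}^{2m}$ with $\mathfrak{so}_{2m}$ by the linear isomorphism that sends $v_1\wedge v_2$ to the endomorphism $u\mapsto (v_1,u)\,v_2-(v_2,u)\,v_1$. Call $\alpha\in\bigwedge^2\mathbb{C}^{2m}$ decomposable if $\alpha=v_1\wedge v_2$ for some $v_1,v_2\in\mathbb{C}^{2m}$, and isotropic if $(\iota_{v_1^*}\alpha,\iota_{v_2^*}\alpha)=0$ for all $v_1^*,v_2^*\in(\mathbb{C}^{2m})^*$, where $\iota_{v^*}(v_1\wedge v_2)=v^*(v_1)\,v_2-v^*(v_2)\,v_1$. Among the adjoint orbits (under $SO_{2m}(\mathbb{C})$) of nilpotent elements of $\mathfrak{so}_{2m}$ there is exactly one, denoted $\mathcal{O}_{\min}$, whose dimension is minimal among those of positive dimension. Its closure, both in the Zariski topology and in the Euclidean topology, is, under the identification above, $$\overline{\mathcal{O}}_{\min}=\Bigl\{\alpha\in\textstyle\bigwedge^2\mathbb{C}^{2m}\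 \Big|\ \alpha\text{ is decomposable and isotropic}\Bigr\}.$$ -/

import Mathlib

noncomputable section

namespace MinOrbit

attribute [local instance 100] LieRing.ofAssociativeRing

/-- The complex vector space `ℂ^{2m}` (column vectors). -/
abbrev V (m : ℕ) : Type := Fin (2 * m) → ℂ

/-- Gram matrix of the form `(e_i, e_j) = δ_{i, 2m+1-j}` (indices `1, …, 2m` in the formula;
`Fin.rev` is the same reflection for indices `0, …, 2m-1`). -/
def J (m : ℕ) : Matrix (Fin (2 * m)) (Fin (2 * m)) ℂ :=
  Matrix.of fun i j => if i = Fin.rev j then 1 else 0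

/-- The bilinear form `( , )` on `ℂ^{2m}`. -/
def form (m : ℕ) : LinearMap.BilinForm ℂ (V m) := Matrix.toBilin' (J m)

/-- The Lie algebra `so_{2m}` of matrices skew-adjoint for the form `( , )`. -/
abbrev so (m : ℕ) : LieSubalgebra ℂ (Matrix (Fin (2 * m)) (Fin (2 * m)) ℂ) :=
  skewAdjointMatricesLieSubalgebra (J m)

/-- The group `SO_{2m}(ℂ)` of matrices of determinant one preserving the form `( , )`. -/
def SO (m : ℕ) : Subgroup (Matrix.SpecialLinearGroup (Fin (2 * m)) ℂ) where
  carrier := {g | g.1.transpose * J m * g.1 = J m}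
  one_mem' := by simp
  mul_mem' := by
    intro a b ha hb
    simp only [Set.mem_ofPred_eq, Matrix.SpecialLinearGroup.coe_mul,
      Matrix.transpose_mul] at *
    calc b.1.transpose * a.1.transpose * J m * (a.1 * b.1)
        = b.1.transpose * (a.1.transpose * J m * a.1) * b.1 := by simp only [Matrix.mul_assoc]
      _ = J m := by rw [ha, hb]
  inv_mem' := by
    intro a ha
    simp only [Set.mem_ofPred_eq] at *
    have h1 : a.1 * (a⁻¹).1 = 1 := by
      rw [← Matrix.SpecialLinearGroup.coe_mul]; simp
    have h2 : (a⁻¹).1.transpose * a.1.transpose = 1 := by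
      rw [← Matrix.transpose_mul, h1, Matrix.transpose_one]
    calc (a⁻¹).1.transpose * J m * (a⁻¹).1
        = (a⁻¹).1.transpose * (a.1.transpose * J m * a.1) * (a⁻¹).1 := by rw [ha]
      _ = ((a⁻¹).1.transpose * a.1.transpose) * J m * (a.1 * (a⁻¹).1) := by
          simp only [Matrix.mul_assoc]
      _ = J m := by rw [h1, h2]; simp

/-- The adjoint orbit `{g X g⁻¹ : g ∈ SO_{2m}(ℂ)}` of `X ∈ so_{2m}`. -/
def adjointOrbit (m : ℕ) (X : so m) : Set (so m) :=
  {Y | ∃ g ∈ SO m, Y.1 = g.1 * X.1 * (g⁻¹).1}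

/-- The complex dimension of the adjoint orbit of `X`, i.e. the dimension of its tangent space
`[so_{2m}, X]` at `X` (equivalently `dim so_{2m} - dim` of the centralizer of `X`). -/
def orbitDim (m : ℕ) (X : so m) : ℕ :=
  Module.finrank ℂ (LinearMap.range (LieAlgebra.ad ℂ (so m) X))

/-- `O` is a nilpotent adjoint orbit of `so_{2m}` of minimal positive dimension. -/
def IsMinimalNilpotentOrbit (m : ℕ) (O : Set (so m)) : Prop :=
  ∃ X : so m, O = adjointOrbit m X ∧ IsNilpotent X.1 ∧ 0 < orbitDim m X ∧
    ∀ Y : so m, IsNilpotent Y.1 → 0 < orbitDim m Y → orbitDim m X ≤ orbitDim m Y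

/-- The Zariski closure of a subset `S` of a complex vector space: the points at which every
polynomial in linear functionals that vanishes on `S` vanishes. -/
def zariskiClosure {W : Type*} [AddCommGroup W] [Module ℂ W] (S : Set W) : Set W :=
  {x | ∀ p : MvPolynomial (Module.Dual ℂ W) ℂ,
    (∀ y ∈ S, MvPolynomial.eval (fun l => l y) p = 0) →
      MvPolynomial.eval (fun l => l x) p = 0}

/-- The bivector `v ∧ w`. -/
def wedge {m : ℕ} (v w : V m) : ⋀[ℂ]^2 (V m) := exteriorPower.ιMulti ℂ 2 ![v, w]

/-- The linear map on bivectors induced by an alternating bilinear map. -/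
def wedgeLift {m : ℕ} {N : Type*} [AddCommGroup N] [Module ℂ N]
    (f : V m →ₗ[ℂ] V m →ₗ[ℂ] N) (hf : ∀ v, f v v = 0) : ⋀[ℂ]^2 (V m) →ₗ[ℂ] N :=
  exteriorPower.alternatingMapLinearEquiv
    { toFun := fun v => f (v 0) (v 1)
      map_update_add' := by
        intro _ v i x y
        fin_cases i <;> simp [Function.update]
      map_update_smul' := by
        intro _ v i c x
        fin_cases i <;> simp [Function.update]
      map_eq_zero_of_eq' := by
        intro v i j h hij
        fin_cases i <;> fin_cases j <;> simp_all }

theorem wedgeLift_wedge {m : ℕ} {N : Type*} [AddCommGroup N] [Module ℂ N]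
    (f : V m →ₗ[ℂ] V m →ₗ[ℂ] N) (hf : ∀ v, f v v = 0) (v w : V m) :
    wedgeLift f hf (wedge v w) = f v w := by
  simp only [wedgeLift, wedge, exteriorPower.alternatingMapLinearEquiv_apply_ιMulti]
  simp

/-- The bilinear map `(v, w) ↦ (u ↦ (v, u) w - (w, u) v)`, as a matrix. -/
def phiBilin (m : ℕ) :
    V m →ₗ[ℂ] V m →ₗ[ℂ] Matrix (Fin (2 * m)) (Fin (2 * m)) ℂ :=
  LinearMap.mk₂ ℂ
    (fun v w => LinearMap.toMatrix'
      ((form m v).smulRight w - (form m w).smulRight v))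
    (by intro a b c; ext i j; simp [LinearMap.toMatrix'_apply]; ring)
    (by intro a b c; ext i j; simp [LinearMap.toMatrix'_apply]; ring)
    (by intro a b c; ext i j; simp [LinearMap.toMatrix'_apply]; ring)
    (by intro a b c; ext i j; simp [LinearMap.toMatrix'_apply]; ring)

/-- The bilinear map `(v, w) ↦ d(v) w - d(w) v`. -/
def contractBilin {m : ℕ} (d : Module.Dual ℂ (V m)) : V m →ₗ[ℂ] V m →ₗ[ℂ] V m :=
  LinearMap.mk₂ ℂ (fun v w => d v • w - d w • v)
    (by intro a b c; simp only [map_add]; module)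
    (by intro a b c; simp only [map_smul, smul_eq_mul]; module)
    (by intro a b c; simp only [map_add]; module)
    (by intro a b c; simp only [map_smul, smul_eq_mul]; module)

/-- The contraction `ι_d : ⋀²ℂ^{2m} → ℂ^{2m}`, `v ∧ w ↦ d(v) w - d(w) v`. -/
def contract {m : ℕ} (d : Module.Dual ℂ (V m)) : ⋀[ℂ]^2 (V m) →ₗ[ℂ] V m :=
  wedgeLift (contractBilin d) (by intro v; simp [contractBilin])

/-- `α` is decomposable: `α = v₁ ∧ v₂` for some vectors `v₁, v₂`. -/
def IsDecomposable {m : ℕ} (α : ⋀[ℂ]^2 (V m)) : Prop := ∃ v₁ v₂ : V m, α = wedge v₁ v₂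

/-- `α` is isotropic: `(ι_d α, ι_{d'} α) = 0` for all linear functionals `d, d'`. -/
def IsIsotropic {m : ℕ} (α : ⋀[ℂ]^2 (V m)) : Prop :=
  ∀ d d' : Module.Dual ℂ (V m), form m (contract d α) (contract d' α) = 0

theorem form_apply (m : ℕ) (v w : V m) : form m v w = ∑ i, v (Fin.rev i) * w i := by
  simp only [form, J, Matrix.toBilin'_apply, Matrix.of_apply]
  rw [Finset.sum_comm]
  simp

theorem form_comm (m : ℕ) (v w : V m) : form m v w = form m w v := by
  rw [form_apply, form_apply, ← Equiv.sum_comp Fin.revPerm]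
  simp [mul_comm]

theorem phiBilin_mulVec (m : ℕ) (v w u : V m) :
    (phiBilin m v w).mulVec u = form m v u • w - form m w u • v := by
  simp only [phiBilin, LinearMap.mk₂_apply, ← Matrix.toLin'_apply, Matrix.toLin'_toMatrix']
  simp

theorem mem_so_iff (m : ℕ) (A : Matrix (Fin (2 * m)) (Fin (2 * m)) ℂ) :
    A ∈ so m ↔ ∀ u v : V m, form m (A.mulVec u) v = - form m u (A.mulVec v) := by
  rw [mem_skewAdjointMatricesLieSubalgebra, mem_skewAdjointMatricesSubmodule,
    Matrix.IsSkewAdjoint, ← isAdjointPair_toLinearMap₂' (R := ℂ)]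
  have h : ∀ u v, Matrix.toLinearMap₂' ℂ (J m) u v = form m u v := fun _ _ => rfl
  simp only [LinearMap.IsAdjointPair, h, Matrix.toLin'_apply, LinearMap.neg_apply, map_neg]

theorem phiBilin_mem (m : ℕ) (v w : V m) : phiBilin m v w ∈ so m := by
  rw [mem_so_iff]
  intro a b
  simp only [phiBilin_mulVec, map_sub, map_smul, LinearMap.sub_apply, LinearMap.smul_apply,
    smul_eq_mul, form_comm m a]
  ring

/-- The linear map `⋀²ℂ^{2m} → so_{2m}` sending `v ∧ w` to `u ↦ (v, u) w - (w, u) v`. -/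
def phi (m : ℕ) : ⋀[ℂ]^2 (V m) →ₗ[ℂ] so m :=
  wedgeLift
    (LinearMap.mk₂ ℂ (fun v w => (⟨phiBilin m v w, phiBilin_mem m v w⟩ : so m))
      (by intro a b c; apply Subtype.ext; simp) (by intro a b c; apply Subtype.ext; simp)
      (by intro a b c; apply Subtype.ext; simp) (by intro a b c; apply Subtype.ext; simp))
    (by intro v; apply Subtype.ext; simp [phiBilin])

theorem phi_wedge_mulVec (m : ℕ) (v w u : V m) :
    (phi m (wedge v w)).1.mulVec u = form m v u • w - form m w u • v := by
  simp only [phi, wedgeLift_wedge, LinearMap.mk₂_apply, phiBilin_mulVec]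

theorem update_zero {m : ℕ} (a b c : V m) : Function.update ![a, c] 0 b = ![b, c] := by
  ext i : 1
  fin_cases i <;> simp

theorem update_one {m : ℕ} (a b c : V m) : Function.update ![a, c] 1 b = ![a, b] := by
  ext i : 1
  fin_cases i <;> simp

/-- `wedge` as a bilinear map. -/
def wedgeBilin (m : ℕ) : V m →ₗ[ℂ] V m →ₗ[ℂ] ⋀[ℂ]^2 (V m) :=
  LinearMap.mk₂ ℂ wedge
    (by intro a b c
        have := (exteriorPower.ιMulti ℂ 2 (M := V m)).map_update_add ![a, c] 0 a b
        simpa only [wedge, update_zero, update_one] using this)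
    (by intro r a c
        have := (exteriorPower.ιMulti ℂ 2 (M := V m)).map_update_smul ![a, c] 0 r a
        simpa only [wedge, update_zero, update_one] using this)
    (by intro a b c
        have := (exteriorPower.ιMulti ℂ 2 (M := V m)).map_update_add ![a, c] 1 b c
        simpa only [wedge, update_zero, update_one] using this)
    (by intro r a c
        have := (exteriorPower.ιMulti ℂ 2 (M := V m)).map_update_smul ![a, c] 1 r c
        simpa only [wedge, update_zero, update_one] using this)

theorem wedge_swap {m : ℕ} (v w : V m) : wedge v w = - wedge w v := by
  have := (exteriorPower.ιMulti ℂ 2 (M := V m)).map_swap ![w, v]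
    (i := 0) (j := 1) (by decide)
  rw [wedge, wedge, ← this]
  congr 1
  ext i : 1
  fin_cases i <;> simp

/-- The map `A ↦ ½ ∑ᵢ e_{2m+1-i} ∧ A eᵢ`, inverse to `phi`. -/
def psi (m : ℕ) : so m →ₗ[ℂ] ⋀[ℂ]^2 (V m) :=
  (2⁻¹ : ℂ) • ∑ i : Fin (2 * m),
    (wedgeBilin m (Pi.single (Fin.rev i) 1)) ∘ₗ
      (LinearMap.applyₗ (Pi.single i 1 : V m)) ∘ₗ
        Matrix.toLin'.toLinearMap ∘ₗ (so m).toSubmodule.subtype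

theorem psi_apply (m : ℕ) (A : so m) :
    psi m A = (2⁻¹ : ℂ) • ∑ i : Fin (2 * m),
      wedgeBilin m (Pi.single (Fin.rev i) 1) (A.1.mulVec (Pi.single i 1)) := by
  simp only [psi, LinearMap.smul_apply, LinearMap.sum_apply]
  rfl

theorem sum_single_rev (m : ℕ) (v : V m) :
    ∑ i : Fin (2 * m), form m v (Pi.single i 1) • (Pi.single (Fin.rev i) 1 : V m) = v := by
  have h : ∀ i, form m v (Pi.single i 1) = v (Fin.rev i) := by
    intro i; rw [form_apply]; simp [Pi.single_apply]
  simp only [h]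
  have := Equiv.sum_comp (Fin.revPerm (n := 2 * m))
    (fun i => v i • (Pi.single i 1 : V m))
  simp only [Fin.revPerm_apply] at this
  rw [this]
  ext j
  simp [Finset.sum_apply, Pi.single_apply]

theorem bivector_hom_ext {m : ℕ} {N : Type*} [AddCommGroup N] [Module ℂ N]
    (f g : ⋀[ℂ]^2 (V m) →ₗ[ℂ] N) (h : ∀ v w, f (wedge v w) = g (wedge v w)) : f = g := by
  apply exteriorPower.linearMap_ext
  ext v
  have hv : v = ![v 0, v 1] := by ext i : 1; fin_cases i <;> rfl
  have := h (v 0) (v 1)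
  rw [wedge, ← hv] at this
  exact this

theorem psi_phi (m : ℕ) : psi m ∘ₗ phi m = LinearMap.id := by
  apply bivector_hom_ext
  intro v w
  simp only [LinearMap.comp_apply, LinearMap.id_apply, psi_apply, phi_wedge_mulVec, map_sub,
    map_smul, Finset.sum_sub_distrib]
  have h : ∀ a b : V m, ∑ i : Fin (2 * m), form m a (Pi.single i 1) •
      wedgeBilin m (Pi.single (Fin.rev i) 1) b = wedge a b := by
    intro a b
    have : wedge a b = wedgeBilin m a b := rfl
    rw [this]
    conv_rhs => rw [← sum_single_rev m a]
    simp [LinearMap.sum_apply]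
  rw [h, h, wedge_swap w v, sub_neg_eq_add, ← two_smul ℂ, smul_smul]
  simp

theorem phi_psi (m : ℕ) : phi m ∘ₗ psi m = LinearMap.id := by
  ext1 A
  apply Subtype.ext
  apply Matrix.ext_of_mulVec_single
  intro k
  have hw : ∀ a b : V m, wedgeBilin m a b = wedge a b := fun _ _ => rfl
  have hA := (mem_so_iff m A.1).1 A.2
  simp only [LinearMap.comp_apply, LinearMap.id_apply, psi_apply, map_smul, map_sum, hw]
  generalize hu : (Pi.single k 1 : V m) = u
  have e1 : ((2⁻¹ : ℂ) • ∑ i : Fin (2 * m), phi m (wedge (Pi.single (Fin.rev i) 1)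
      (A.1.mulVec (Pi.single i 1)))).1.mulVec u = (2⁻¹ : ℂ) • ∑ i : Fin (2 * m),
      (phi m (wedge (Pi.single (Fin.rev i) 1) (A.1.mulVec (Pi.single i 1)))).1.mulVec u := by
    simp [Matrix.smul_mulVec, Matrix.sum_mulVec]
  rw [e1]
  simp only [phi_wedge_mulVec, hA, neg_smul, sub_neg_eq_add, Finset.sum_add_distrib]
  have e2 : ∑ i : Fin (2 * m), form m (Pi.single (Fin.rev i) 1) u •
      A.1.mulVec (Pi.single i 1) = A.1.mulVec u := by
    have : ∀ i, form m (Pi.single (Fin.rev i) 1) u = u i := by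
      intro i; rw [form_apply]; simp [Pi.single_apply]
    simp only [this, ← Matrix.mulVec_smul, ← Matrix.mulVec_sum]
    congr 1
    ext j
    simp [Finset.sum_apply, Pi.single_apply]
  have e3 : ∑ i : Fin (2 * m), form m (Pi.single i 1) (A.1.mulVec u) •
      (Pi.single (Fin.rev i) 1 : V m) = A.1.mulVec u := by
    conv_rhs => rw [← sum_single_rev m (A.1.mulVec u)]
    simp only [form_comm m (A.1.mulVec u)]
  rw [e2, e3, ← two_smul ℂ, smul_smul]
  simp

/-- The identification `⋀²ℂ^{2m} = so_{2m}`, under which `v ∧ w` corresponds to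
`u ↦ (v, u) w - (w, u) v`. -/
def bivectorEquivSo (m : ℕ) : ⋀[ℂ]^2 (V m) ≃ₗ[ℂ] so m :=
  LinearEquiv.ofLinearMap (phi m) (psi m) (phi_psi m) (psi_phi m)

end MinOrbit

end

noncomputable section

namespace MinOrbit

attribute [local instance 100] LieRing.ofAssociativeRing

open Module

variable {m : ℕ}

/-! Everything is compared with `isotropicCone`, the set of images of `v ∧ w` with `v, w` spanning a
totally isotropic subspace. Contracting `α = v ∧ w` with the functional `(·, u)` gives `A u`, where
`A` is the image of `α`. Isotropy of `α` therefore means `A² = 0`, and decomposability bounds the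
rank of `A` by 2, so the right-hand side of the theorem is the cone
(`isDecomposable_and_isIsotropic_iff`).

The nonzero part of the cone is one orbit, by Witt's theorem for isotropic planes with the
determinant corrected by a reflection (`adjointOrbit_eq`). Its dimension is `4m - 6`
(`le_orbitDim_of_mem_isotropicCone`, `orbitDim_le_of_mem_isotropicCone`). A nilpotent `Y` outside
the cone has `Y² ≠ 0`, or `Y² = 0` and rank at least 3. In both cases bounding the centralizer gives
an orbit of larger dimension (`lt_orbitDim_of_notMem_isotropicCone`), so the minimal orbit is the
cone without zero.

The cone is cut out by quadrics (`mem_isotropicCone_iff`), hence Zariski closed. Scaling puts zero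
in the Euclidean closure of the rest, which lies in the Zariski closure, so both closures equal the
cone. -/

/-! ### The form and its skew-adjoint matrices. -/

theorem form_single_right (v : V m) (i : Fin (2 * m)) :
    form m v (Pi.single i 1) = v (Fin.rev i) := by
  rw [form_apply]; simp [Pi.single_apply]

theorem eq_zero_of_form_eq_zero {v : V m} (h : ∀ u, form m v u = 0) : v = 0 := by
  ext i
  have := h (Pi.single (Fin.rev i) 1)
  rw [form_single_right, Fin.rev_rev] at this
  simpa using this

theorem form_nondegenerate (m : ℕ) : (form m).Nondegenerate := by
  refine ⟨fun v h => eq_zero_of_form_eq_zero h, fun v h => eq_zero_of_form_eq_zero fun u => ?_⟩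
  rw [form_comm]; exact h u

theorem form_mulVec_left (A : so m) (u v : V m) :
    form m (A.1.mulVec u) v = - form m u (A.1.mulVec v) :=
  (mem_so_iff m A.1).1 A.2 u v

theorem form_mulVec_comm (A : so m) (u v : V m) :
    form m (A.1.mulVec u) v = - form m (A.1.mulVec v) u := by
  rw [form_mulVec_left, form_comm m u]

theorem form_mulVec_self (A : so m) (u : V m) : form m (A.1.mulVec u) u = 0 := by
  have := form_mulVec_comm A u u
  exact self_eq_neg.1 this

theorem so_ext {A B : so m} (h : ∀ u, A.1.mulVec u = B.1.mulVec u) : A = B :=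
  Subtype.ext (Matrix.ext_of_mulVec_single fun _ => h _)

theorem exists_dual_eq_form (d : Dual ℂ (V m)) : ∃ u : V m, ∀ v, d v = form m v u := by
  refine ⟨fun i => d (Pi.single (Fin.rev i) 1), fun v => ?_⟩
  conv_lhs => rw [← sum_single_rev m v]
  rw [map_sum, form_apply]
  refine Finset.sum_congr rfl fun i _ => ?_
  rw [map_smul, form_single_right, smul_eq_mul]

/-! ### Isotropic decomposable bivectors as matrices. -/

/-- The pair `v, w` spans a totally isotropic subspace. -/
def IsotropicPair (v w : V m) : Prop :=
  form m v v = 0 ∧ form m v w = 0 ∧ form m w w = 0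

theorem mulVec_mulVec_phi {v w : V m} (h : IsotropicPair v w) (u : V m) :
    (phi m (wedge v w)).1.mulVec ((phi m (wedge v w)).1.mulVec u) = 0 := by
  obtain ⟨h1, h2, h3⟩ := h
  have h4 : form m w v = 0 := by rw [form_comm, h2]
  simp [phi_wedge_mulVec, h1, h2, h3, h4]

/-- A square-zero element of `so` that takes the values `A a`, `A b` with `(A a, b) = 1` and
whose range is spanned by them is the image of a bivector. -/
theorem eq_phi_of_mem_span {A : so m} {a b : V m} (hab : form m (A.1.mulVec a) b = 1)
    (h : ∀ u, A.1.mulVec u ∈ Submodule.span ℂ {A.1.mulVec a, A.1.mulVec b}) :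
    A = phi m (wedge (A.1.mulVec a) (A.1.mulVec b)) := by
  apply so_ext
  intro u
  obtain ⟨c, d, hcd⟩ := Submodule.mem_span_pair.1 (h u)
  have hba : form m (A.1.mulVec b) a = -1 := by rw [form_mulVec_comm, hab]
  -- Pairing with `a` and `b` recovers both coefficients, since `(A a, a) = (A b, b) = 0`.
  have ha := congrArg (fun x => form m x a) hcd
  have hb := congrArg (fun x => form m x b) hcd
  simp only [map_add, map_smul, LinearMap.add_apply, LinearMap.smul_apply, form_mulVec_self,
    hab, hba, smul_eq_mul] at ha hb
  rw [phi_wedge_mulVec, form_mulVec_comm A a u, form_mulVec_comm A b u, ← ha, ← hb, ← hcd]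
  module

theorem exists_form_mulVec_eq_one {A : so m} (hA : A ≠ 0) :
    ∃ a b : V m, form m (A.1.mulVec a) b = 1 := by
  by_contra! h
  refine hA (so_ext fun u => ?_)
  simp only [ZeroMemClass.coe_zero, Matrix.zero_mulVec]
  refine eq_zero_of_form_eq_zero fun w => ?_
  by_contra hw
  refine h u ((form m (A.1.mulVec u) w)⁻¹ • w) ?_
  simp [hw]

theorem linearIndependent_of_form_eq_one {A : so m} {a b : V m}
    (hab : form m (A.1.mulVec a) b = 1) :
    LinearIndependent ℂ ![A.1.mulVec a, A.1.mulVec b] := by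
  rw [LinearIndependent.pair_iff]
  intro s t hst
  have hba : form m (A.1.mulVec b) a = -1 := by rw [form_mulVec_comm, hab]
  have ha := congrArg (fun x => form m x a) hst
  have hb := congrArg (fun x => form m x b) hst
  simp only [map_add, map_smul, LinearMap.add_apply, LinearMap.smul_apply, form_mulVec_self,
    hab, hba, smul_eq_mul, map_zero, LinearMap.zero_apply] at ha hb
  constructor
  · simpa using hb
  · simpa using ha

theorem isotropicPair_mulVec {A : so m} (hA : ∀ u, A.1.mulVec (A.1.mulVec u) = 0) (a b : V m) :
    IsotropicPair (A.1.mulVec a) (A.1.mulVec b) := by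
  have h : ∀ x y, form m (A.1.mulVec x) (A.1.mulVec y) = 0 := fun x y => by
    rw [form_mulVec_left, hA, map_zero, neg_zero]
  exact ⟨h _ _, h _ _, h _ _⟩

/-- The images in `so` of the bivectors of isotropic planes, together with zero. -/
def isotropicCone (m : ℕ) : Set (so m) :=
  {A | ∃ v w : V m, IsotropicPair v w ∧ A = phi m (wedge v w)}

theorem wedge_eq_zero_of_dependent {v w : V m} (h : ¬ LinearIndependent ℂ ![v, w]) :
    wedge v w = 0 :=
  (exteriorPower.ιMulti ℂ 2).map_linearDependent _ h

theorem linearIndependent_of_phi_ne_zero {v w : V m} (h : phi m (wedge v w) ≠ 0) :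
    LinearIndependent ℂ ![v, w] := by
  by_contra hd
  exact h (by rw [wedge_eq_zero_of_dependent hd, map_zero])

/-- A pair with `(A a, b) = 1` already gives two independent values. If they spanned the range, `A`
would be the image of their wedge, which is isotropic because `A² = 0`. -/
theorem exists_independent_image_of_notMem_isotropicCone {A : so m}
    (hA : ∀ u, A.1.mulVec (A.1.mulVec u) = 0) (hc : A ∉ isotropicCone m) :
    ∃ a b c : V m, LinearIndependent ℂ ![A.1.mulVec a, A.1.mulVec b, A.1.mulVec c] := by
  have h0 : A ≠ 0 := by
    rintro rfl
    refine hc ⟨0, 0, by simp [IsotropicPair], ?_⟩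
    rw [wedge_eq_zero_of_dependent, map_zero]
    intro h
    exact h.ne_zero 0 rfl
  obtain ⟨a, b, hab⟩ := exists_form_mulVec_eq_one h0
  by_cases h : ∀ u, A.1.mulVec u ∈ Submodule.span ℂ {A.1.mulVec a, A.1.mulVec b}
  · exact absurd ⟨_, _, isotropicPair_mulVec hA a b, eq_phi_of_mem_span hab h⟩ hc
  · push Not at h
    obtain ⟨u, hu⟩ := h
    refine ⟨u, a, b, ?_⟩
    refine linearIndependent_finCons.2 ⟨linearIndependent_of_form_eq_one hab, ?_⟩
    rwa [Matrix.range_cons_cons_empty]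

theorem contract_eq_mulVec {v w u : V m} {d : Dual ℂ (V m)} (h : ∀ x, d x = form m x u) :
    contract d (wedge v w) = (phi m (wedge v w)).1.mulVec u := by
  rw [contract, wedgeLift_wedge, phi_wedge_mulVec]
  simp [contractBilin, h]

theorem bivectorEquivSo_apply (α : ⋀[ℂ]^2 (V m)) : bivectorEquivSo m α = phi m α := rfl

theorem isDecomposable_and_isIsotropic_iff (α : ⋀[ℂ]^2 (V m)) :
    IsDecomposable α ∧ IsIsotropic α ↔ bivectorEquivSo m α ∈ isotropicCone m := by
  rw [bivectorEquivSo_apply]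
  constructor
  · rintro ⟨⟨v, w, rfl⟩, hi⟩
    set A := phi m (wedge v w) with hAdef
    have hA : ∀ u, A.1.mulVec (A.1.mulVec u) = 0 := by
      intro u
      refine eq_zero_of_form_eq_zero fun x => ?_
      rw [form_mulVec_left]
      have := hi ((form m).flip u) ((form m).flip x)
      rw [contract_eq_mulVec (u := u) fun _ => rfl, contract_eq_mulVec (u := x) fun _ => rfl]
        at this
      rw [this, neg_zero]
    -- The given `v, w` need not be isotropic when they are dependent, so the argument goes through
    -- the rank: outside the cone there would be three independent vectors in the span of two.
    by_contra hc
    obtain ⟨a, b, c, habc⟩ := exists_independent_image_of_notMem_isotropicCone hA hc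
    have hle : Submodule.span ℂ (Set.range ![A.1.mulVec a, A.1.mulVec b, A.1.mulVec c]) ≤
        Submodule.span ℂ (Set.range ![v, w]) := by
      rw [Submodule.span_le]
      rintro _ ⟨i, rfl⟩
      have : ∀ u, A.1.mulVec u ∈ Submodule.span ℂ (Set.range ![v, w]) := fun u => by
        rw [hAdef, phi_wedge_mulVec, Matrix.range_cons_cons_empty]
        exact sub_mem (Submodule.smul_mem _ _ (Submodule.subset_span (by simp)))
          (Submodule.smul_mem _ _ (Submodule.subset_span (by simp)))
      fin_cases i <;> exact this _
    have h1 := Submodule.finrank_mono hle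
    rw [finrank_span_eq_card habc] at h1
    have h2 := finrank_range_le_card (R := ℂ) ![v, w]
    exact absurd (h1.trans h2) (by simp)
  · rintro ⟨v, w, hvw, h⟩
    have : α = wedge v w := (bivectorEquivSo m).injective h
    subst this
    refine ⟨⟨v, w, rfl⟩, fun d d' => ?_⟩
    obtain ⟨u, hu⟩ := exists_dual_eq_form d
    obtain ⟨u', hu'⟩ := exists_dual_eq_form d'
    rw [contract_eq_mulVec hu, contract_eq_mulVec hu', form_mulVec_left, mulVec_mulVec_phi hvw,
      map_zero, neg_zero]

/-! ### Centralizers and lower bounds for orbit dimensions. -/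

theorem finrank_map_add_finrank_inf_ker {E F : Type*} [AddCommGroup E] [Module ℂ E]
    [AddCommGroup F] [Module ℂ F] [FiniteDimensional ℂ E] (f : E →ₗ[ℂ] F) (W : Submodule ℂ E) :
    finrank ℂ (W.map f) + finrank ℂ (W ⊓ LinearMap.ker f : Submodule ℂ E) = finrank ℂ W := by
  rw [← LinearMap.finrank_range_add_finrank_ker (f.domRestrict W), LinearMap.range_domRestrict,
    LinearMap.ker_domRestrict, ← Submodule.map_comap_subtype, Submodule.finrank_map_subtype_eq]

/-- Evaluation of elements of `so` at a vector. -/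
def evalAt (v : V m) : so m →ₗ[ℂ] V m where
  toFun A := A.1.mulVec v
  map_add' A B := by simp [Matrix.add_mulVec]
  map_smul' c A := by simp [Matrix.smul_mulVec]

/-- Rank-nullity for evaluation at `v`: the values lie in the orthogonal complement of the `t i`, of
dimension `2m - k`. Iterating this bounds centralizers. -/
theorem finrank_le_add_finrank_inf_ker_evalAt (W : Submodule ℂ (so m)) (v : V m) {k : ℕ}
    {t : Fin k → V m} (ht : LinearIndependent ℂ t)
    (h : ∀ A ∈ W, ∀ i, form m (t i) (A.1.mulVec v) = 0) :
    finrank ℂ W ≤ (2 * m - k) + finrank ℂ (W ⊓ LinearMap.ker (evalAt v) : Submodule ℂ (so m)) := by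
  have h1 := finrank_map_add_finrank_inf_ker (evalAt v) W
  have h3 : W.map (evalAt v) ≤ (form m).orthogonal (Submodule.span ℂ (Set.range t)) := by
    rintro _ ⟨A, hA, rfl⟩
    rw [LinearMap.BilinForm.mem_orthogonal_iff]
    intro x hx
    have hle : Submodule.span ℂ (Set.range t) ≤ LinearMap.ker ((form m).flip (A.1.mulVec v)) := by
      rw [Submodule.span_le]
      rintro _ ⟨i, rfl⟩
      exact h A hA i
    exact hle hx
  have h4 := Submodule.finrank_mono h3
  rw [LinearMap.BilinForm.finrank_orthogonal (form_nondegenerate m), finrank_span_eq_card ht,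
    Module.finrank_fin_fun, Fintype.card_fin] at h4
  omega

/-- Evaluate at a vector `v` outside the span of `t`: by skewness `A v` is orthogonal to `v` and to
every `t i`, so one more vector is killed at a cost of `2m - k - 1` dimensions. These costs add up
to the binomial coefficient. -/
theorem finrank_le_choose (W : Submodule ℂ (so m)) {k : ℕ}
    {t : Fin k → V m} (ht : LinearIndependent ℂ t)
    (h : ∀ A ∈ W, ∀ i, A.1.mulVec (t i) = 0) :
    finrank ℂ W ≤ (2 * m - k).choose 2 := by
  have hk : k ≤ 2 * m := by simpa using ht.fintype_card_le_finrank
  induction hn : 2 * m - k generalizing k W with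
  | zero =>
    have htop : Submodule.span ℂ (Set.range t) = ⊤ :=
      ht.span_eq_top_of_card_eq_finrank' (by simp; omega)
    have hW : W = ⊥ := by
      rw [eq_bot_iff]
      intro A hA
      rw [Submodule.mem_bot]
      refine so_ext fun u => ?_
      have hle : Submodule.span ℂ (Set.range t) ≤ LinearMap.ker (Matrix.toLin' A.1) := by
        rw [Submodule.span_le]
        rintro _ ⟨i, rfl⟩
        exact h A hA i
      have : u ∈ LinearMap.ker (Matrix.toLin' A.1) := hle (htop ▸ Submodule.mem_top)
      simpa using this
    subst hW
    simp
  | succ n ih =>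
    have hne : Submodule.span ℂ (Set.range t) ≠ ⊤ := by
      intro htop
      have := finrank_span_eq_card ht
      rw [htop, finrank_top] at this
      simp at this
      omega
    obtain ⟨v, hv⟩ : ∃ v, v ∉ Submodule.span ℂ (Set.range t) := by
      by_contra! hall
      exact hne (eq_top_iff.2 fun x _ => hall x)
    have ht' : LinearIndependent ℂ (Fin.cons v t : Fin (k + 1) → V m) :=
      linearIndependent_finCons.2 ⟨ht, hv⟩
    have h1 := finrank_le_add_finrank_inf_ker_evalAt W v ht' (by
      intro A hA i
      refine Fin.cases ?_ (fun j => ?_) i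
      · rw [Fin.cons_zero, form_comm, form_mulVec_self]
      · rw [Fin.cons_succ, ← neg_eq_zero, ← form_mulVec_left, h A hA, map_zero,
          LinearMap.zero_apply])
    have h2 := ih (W ⊓ LinearMap.ker (evalAt v)) ht' (by
      intro A hA i
      refine Fin.cases ?_ (fun j => ?_) i
      · exact hA.2
      · exact h A hA.1 j) (by omega) (by omega)
    have h3 : (n + 1).choose 2 = n + n.choose 2 := by
      rw [Nat.choose_succ_succ, Nat.choose_one_right]
    omega

theorem finrank_so (m : ℕ) : finrank ℂ (so m) = (2 * m).choose 2 := by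
  rw [← (bivectorEquivSo m).finrank_eq, exteriorPower.finrank_eq, Module.finrank_fin_fun]

/-- The centralizer of `Y` in `so`. -/
def centralizer (Y : so m) : Submodule ℂ (so m) := LinearMap.ker (LieAlgebra.ad ℂ (so m) Y)

theorem orbitDim_add_finrank_centralizer (Y : so m) :
    orbitDim m Y + finrank ℂ (centralizer Y) = (2 * m).choose 2 := by
  rw [← finrank_so]
  exact LinearMap.finrank_range_add_finrank_ker (LieAlgebra.ad ℂ (so m) Y : so m →ₗ[ℂ] so m)

theorem mulVec_comm_of_mem_centralizer {Y A : so m} (h : A ∈ centralizer Y) (v : V m) :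
    A.1.mulVec (Y.1.mulVec v) = Y.1.mulVec (A.1.mulVec v) := by
  have h1 : ⁅Y, A⁆ = 0 := h
  have h2 : Y.1 * A.1 - A.1 * Y.1 = 0 := congrArg Subtype.val h1
  rw [Matrix.mulVec_mulVec, Matrix.mulVec_mulVec, sub_eq_zero.1 h2]

theorem form_mulVec_sq_of_mem_centralizer {Y A : so m} (h : A ∈ centralizer Y) (v : V m) :
    form m (Y.1.mulVec (Y.1.mulVec v)) (A.1.mulVec v) = 0 := by
  rw [form_mulVec_left, ← mulVec_comm_of_mem_centralizer h, form_comm, form_mulVec_self, neg_zero]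

theorem choose_two_add_one (k : ℕ) : (k + 1).choose 2 = k + k.choose 2 := by
  rw [Nat.choose_succ_succ, Nat.choose_one_right]

/-- The vector `Y v` comes first so that the tail of the family is `v, Y² v`, the constraints needed
when evaluating the centralizer at `v`. -/
theorem linearIndependent_mulVec_sq {Y : Matrix (Fin (2 * m)) (Fin (2 * m)) ℂ} (hY : IsNilpotent Y)
    {v : V m} (hv : Y.mulVec (Y.mulVec v) ≠ 0) :
    LinearIndependent ℂ ![Y.mulVec v, v, Y.mulVec (Y.mulVec v)] := by
  classical
  obtain ⟨n, hn⟩ := hY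
  have hex : ∃ n, (Y ^ n).mulVec v = 0 := ⟨n, by rw [hn, Matrix.zero_mulVec]⟩
  have hp : ∀ a b : ℕ, (Y ^ a).mulVec ((Y ^ b).mulVec v) = (Y ^ (a + b)).mulVec v := fun a b => by
    rw [Matrix.mulVec_mulVec, pow_add]
  have hz : ∀ k, Nat.find hex ≤ k → (Y ^ k).mulVec v = 0 := fun k hk => by
    obtain ⟨j, rfl⟩ := Nat.exists_eq_add_of_le' hk
    rw [← hp, Nat.find_spec hex, Matrix.mulVec_zero]
  have h1 : Y.mulVec v = (Y ^ 1).mulVec v := by rw [pow_one]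
  have h2 : Y.mulVec (Y.mulVec v) = (Y ^ 2).mulVec v := by rw [Matrix.mulVec_mulVec, pow_two]
  have h0 : v = (Y ^ 0).mulVec v := by rw [pow_zero, Matrix.one_mulVec]
  have h3 : 2 < Nat.find hex := by
    by_contra hlt
    exact hv (h2 ▸ hz 2 (not_lt.1 hlt))
  obtain ⟨N, hN⟩ : ∃ N, Nat.find hex = N + 3 := Nat.exists_eq_add_of_le' h3
  have hne : (Y ^ (N + 2)).mulVec v ≠ 0 := Nat.find_min hex (by omega)
  rw [hN] at hz
  rw [h2, h1]
  nth_rewrite 2 [h0]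
  rw [Fintype.linearIndependent_iff]
  intro g hg
  simp only [Fin.sum_univ_three, Matrix.cons_val_zero, Matrix.cons_val_one, Matrix.cons_val] at hg
  -- With `N + 3` the least exponent killing `v`, applying `Y ^ (N + 2)`, `Y ^ (N + 1)` and `Y ^ N`
  -- in turn isolates the coefficients of `v`, `Y v` and `Y² v`.
  have app : ∀ k, g 0 • (Y ^ (k + 1)).mulVec v + g 1 • (Y ^ (k + 0)).mulVec v +
      g 2 • (Y ^ (k + 2)).mulVec v = 0 := fun k => by
    have := congrArg (fun x => (Y ^ k).mulVec x) hg
    simpa only [Matrix.mulVec_add, Matrix.mulVec_smul, hp, Matrix.mulVec_zero] using this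
  have g1 : g 1 = 0 := by
    have := app (N + 2)
    rw [hz (N + 2 + 1) (by omega), hz (N + 2 + 2) (by omega)] at this
    simpa [hne] using this
  have g0 : g 0 = 0 := by
    have := app (N + 1)
    rw [hz (N + 1 + 2) (by omega), g1] at this
    simpa [hne] using this
  have g2 : g 2 = 0 := by
    have := app N
    rw [g0, g1] at this
    simpa [hne] using this
  intro i
  fin_cases i <;> assumption

/-- For `A` in the centralizer, `A v` is orthogonal to `v` and `Y² v`; if `A v = 0`, then `A` also
kills `Y v` and `Y² v`. The resulting bound on the orbit dimension is `4m - 4`. -/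
theorem lt_orbitDim_of_sq_ne_zero (hm : 4 ≤ m) {Y : so m} (hY : IsNilpotent Y.1) {v : V m}
    (hv : Y.1.mulVec (Y.1.mulVec v) ≠ 0) : 4 * m - 6 < orbitDim m Y := by
  have hi := linearIndependent_mulVec_sq hY hv
  have h1 := finrank_le_add_finrank_inf_ker_evalAt (centralizer Y) v
    (linearIndependent_finCons.1 hi).1 (by
      intro A hA i
      fin_cases i
      · exact (form_comm _ _ _).trans (form_mulVec_self A v)
      · exact form_mulVec_sq_of_mem_centralizer hA v)
  have h2 := finrank_le_choose (centralizer Y ⊓ LinearMap.ker (evalAt v)) hi (by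
    rintro A ⟨hA, hAv⟩ i
    have hAv : A.1.mulVec v = 0 := hAv
    have hYv : A.1.mulVec (Y.1.mulVec v) = 0 := by
      rw [mulVec_comm_of_mem_centralizer hA, hAv, Matrix.mulVec_zero]
    fin_cases i
    · exact hYv
    · exact hAv
    · exact (mulVec_comm_of_mem_centralizer hA _).trans (by rw [hYv, Matrix.mulVec_zero]))
  have h3 := orbitDim_add_finrank_centralizer Y
  -- This substitution removes truncated subtraction, and unrolling the binomials makes the count
  -- linear.
  obtain ⟨k, hk⟩ : ∃ k, 2 * m = k + 3 := ⟨2 * m - 3, by omega⟩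
  have e1 := choose_two_add_one k
  have e2 : (k + 2).choose 2 = k + 1 + (k + 1).choose 2 := choose_two_add_one _
  have e3 : (k + 3).choose 2 = k + 2 + (k + 2).choose 2 := choose_two_add_one _
  have hN : (2 * m).choose 2 = (k + 3).choose 2 := by rw [hk]
  have hK : (2 * m - 3).choose 2 = k.choose 2 := by rw [hk, Nat.add_sub_cancel]
  simp only [Nat.succ_eq_add_one, Nat.reduceAdd] at h1 h2
  omega

/-- If `Y² = 0`, then independent values of `Y` form an independent family with their
preimages. -/
theorem linearIndependent_sumElim_mulVec {Y : so m} (hY : ∀ u, Y.1.mulVec (Y.1.mulVec u) = 0)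
    {k : ℕ} {v : Fin k → V m} (hv : LinearIndependent ℂ fun i => Y.1.mulVec (v i)) :
    LinearIndependent ℂ (Sum.elim (fun i => Y.1.mulVec (v i)) v) := by
  rw [Fintype.linearIndependent_iff] at hv ⊢
  intro g hg
  simp only [Fintype.sum_sum_type, Sum.elim_inl, Sum.elim_inr] at hg
  have h1 : ∀ i, g (Sum.inr i) = 0 := by
    refine hv _ ?_
    have := congrArg (fun x => Y.1.mulVec x) hg
    simpa [Matrix.mulVec_add, Matrix.mulVec_sum, Matrix.mulVec_smul, hY] using this
  have h2 : ∀ i, g (Sum.inl i) = 0 := by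
    refine hv _ ?_
    simpa [h1] using hg
  rintro (i | i)
  · exact h2 i
  · exact h1 i

/-- The centralizer is evaluated at `c`, `b`, `a` in turn; killing a vector forces killing its image
under `Y`. The images lie in spaces of dimension `2m - 1`, `2m - 3`, `2m - 5`, and what remains
kills six independent vectors. The orbit dimension is at least `6m - 12`, which exceeds `4m - 6`
exactly when `m > 3`. -/
theorem lt_orbitDim_of_three_independent (hm : 4 ≤ m) {Y : so m}
    (hY : ∀ u, Y.1.mulVec (Y.1.mulVec u) = 0) {a b c : V m}
    (hi : LinearIndependent ℂ ![Y.1.mulVec a, Y.1.mulVec b, Y.1.mulVec c]) :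
    4 * m - 6 < orbitDim m Y := by
  have h0 : LinearIndependent ℂ
      ![Y.1.mulVec a, a, Y.1.mulVec b, b, Y.1.mulVec c, c] := by
    have := linearIndependent_sumElim_mulVec hY (v := ![a, b, c]) (by
      convert hi using 1; ext i : 1; fin_cases i <;> rfl)
    have := this.comp ![Sum.inl 0, Sum.inr 0, Sum.inl 1, Sum.inr 1, Sum.inl 2, Sum.inr 2]
      (by decide)
    convert this using 1
    ext i : 1
    fin_cases i <;> rfl
  -- The interleaved order makes the tails of lengths 5, 3 and 1 the constraint families for
  -- evaluation at `a`, `b` and `c`.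
  have t5 := (linearIndependent_finCons.1 h0).1
  have t3 := (linearIndependent_finCons.1 (linearIndependent_finCons.1 t5).1).1
  have t1 := (linearIndependent_finCons.1 (linearIndependent_finCons.1 t3).1).1
  have hself : ∀ (A : so m) (v : V m), form m v (A.1.mulVec v) = 0 := fun A v => by
    rw [form_comm, form_mulVec_self]
  have hkill : ∀ (A : so m) (v w : V m), A.1.mulVec v = 0 → form m v (A.1.mulVec w) = 0 :=
    fun A v w h => by rw [← neg_eq_zero, ← form_mulVec_left, h, map_zero, LinearMap.zero_apply]
  have hcomm : ∀ (A : so m) (v : V m), A ∈ centralizer Y → A.1.mulVec v = 0 →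
      A.1.mulVec (Y.1.mulVec v) = 0 := fun A v hA h => by
    rw [mulVec_comm_of_mem_centralizer hA, h, Matrix.mulVec_zero]
  have h1 := finrank_le_add_finrank_inf_ker_evalAt (centralizer Y) c t1 (by
    intro A hA i
    fin_cases i
    exact hself A c)
  have h2 := finrank_le_add_finrank_inf_ker_evalAt (centralizer Y ⊓ LinearMap.ker (evalAt c)) b t3
    (by
      rintro A ⟨hA, hc⟩ i
      fin_cases i
      exacts [hself A b, hkill A _ b (hcomm A c hA hc), hkill A c b hc])
  have h3 := finrank_le_add_finrank_inf_ker_evalAt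
    (centralizer Y ⊓ LinearMap.ker (evalAt c) ⊓ LinearMap.ker (evalAt b)) a t5 (by
      rintro A ⟨⟨hA, hc⟩, hb⟩ i
      fin_cases i
      exacts [hself A a, hkill A _ a (hcomm A b hA hb), hkill A b a hb,
        hkill A _ a (hcomm A c hA hc), hkill A c a hc])
  have h4 := finrank_le_choose (centralizer Y ⊓ LinearMap.ker (evalAt c) ⊓
    LinearMap.ker (evalAt b) ⊓ LinearMap.ker (evalAt a)) h0 (by
      rintro A ⟨⟨⟨hA, hc⟩, hb⟩, ha⟩ i
      fin_cases i
      exacts [hcomm A a hA ha, ha, hcomm A b hA hb, hb, hcomm A c hA hc, hc])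
  have h5 := orbitDim_add_finrank_centralizer Y
  obtain ⟨k, hk⟩ : ∃ k, 2 * m = k + 6 := ⟨2 * m - 6, by omega⟩
  have e1 := choose_two_add_one k
  have e2 : (k + 2).choose 2 = k + 1 + (k + 1).choose 2 := choose_two_add_one _
  have e3 : (k + 3).choose 2 = k + 2 + (k + 2).choose 2 := choose_two_add_one _
  have e4 : (k + 4).choose 2 = k + 3 + (k + 3).choose 2 := choose_two_add_one _
  have e5 : (k + 5).choose 2 = k + 4 + (k + 4).choose 2 := choose_two_add_one _
  have e6 : (k + 6).choose 2 = k + 5 + (k + 5).choose 2 := choose_two_add_one _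
  have hN : (2 * m).choose 2 = (k + 6).choose 2 := by rw [hk]
  have hK : (2 * m - 6).choose 2 = k.choose 2 := by rw [hk, Nat.add_sub_cancel]
  simp only [Nat.succ_eq_add_one, Nat.reduceAdd] at h1 h2 h3 h4
  omega

theorem lt_orbitDim_of_notMem_isotropicCone (hm : 4 ≤ m) {Y : so m} (hY : IsNilpotent Y.1)
    (hc : Y ∉ isotropicCone m) : 4 * m - 6 < orbitDim m Y := by
  by_cases h : ∀ u, Y.1.mulVec (Y.1.mulVec u) = 0
  · obtain ⟨a, b, c, hi⟩ := exists_independent_image_of_notMem_isotropicCone h hc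
    exact lt_orbitDim_of_three_independent hm h hi
  · push Not at h
    obtain ⟨v, hv⟩ := h
    exact lt_orbitDim_of_sq_ne_zero hm hY hv

/-- The same count with two evaluations, of cost `2m - 1` and `2m - 3`, and four killed vectors. -/
theorem le_orbitDim_of_mem_isotropicCone (hm : 4 ≤ m) {Y : so m} (hY : Y ∈ isotropicCone m)
    (h0 : Y ≠ 0) : 4 * m - 6 ≤ orbitDim m Y := by
  have hsq : ∀ u, Y.1.mulVec (Y.1.mulVec u) = 0 := by
    obtain ⟨v, w, hvw, rfl⟩ := hY
    exact mulVec_mulVec_phi hvw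
  obtain ⟨a, b, hab⟩ := exists_form_mulVec_eq_one h0
  have hi : LinearIndependent ℂ ![Y.1.mulVec a, a, Y.1.mulVec b, b] := by
    have := linearIndependent_sumElim_mulVec hsq (v := ![a, b]) (by
      convert linearIndependent_of_form_eq_one hab using 1; ext i : 1; fin_cases i <;> rfl)
    have := this.comp ![Sum.inl 0, Sum.inr 0, Sum.inl 1, Sum.inr 1] (by decide)
    convert this using 1
    ext i : 1
    fin_cases i <;> rfl
  have t3 := (linearIndependent_finCons.1 hi).1
  have t1 := (linearIndependent_finCons.1 (linearIndependent_finCons.1 t3).1).1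
  have hself : ∀ (A : so m) (v : V m), form m v (A.1.mulVec v) = 0 := fun A v => by
    rw [form_comm, form_mulVec_self]
  have hkill : ∀ (A : so m) (v w : V m), A.1.mulVec v = 0 → form m v (A.1.mulVec w) = 0 :=
    fun A v w h => by rw [← neg_eq_zero, ← form_mulVec_left, h, map_zero, LinearMap.zero_apply]
  have hcomm : ∀ (A : so m) (v : V m), A ∈ centralizer Y → A.1.mulVec v = 0 →
      A.1.mulVec (Y.1.mulVec v) = 0 := fun A v hA h => by
    rw [mulVec_comm_of_mem_centralizer hA, h, Matrix.mulVec_zero]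
  have h1 := finrank_le_add_finrank_inf_ker_evalAt (centralizer Y) b t1 (by
    intro A hA i
    fin_cases i
    exact hself A b)
  have h2 := finrank_le_add_finrank_inf_ker_evalAt (centralizer Y ⊓ LinearMap.ker (evalAt b)) a t3
    (by
      rintro A ⟨hA, hb⟩ i
      fin_cases i
      exacts [hself A a, hkill A _ a (hcomm A b hA hb), hkill A b a hb])
  have h3 := finrank_le_choose (centralizer Y ⊓ LinearMap.ker (evalAt b) ⊓
    LinearMap.ker (evalAt a)) hi (by
      rintro A ⟨⟨hA, hb⟩, ha⟩ i
      fin_cases i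
      exacts [hcomm A a hA ha, ha, hcomm A b hA hb, hb])
  have h5 := orbitDim_add_finrank_centralizer Y
  obtain ⟨k, hk⟩ : ∃ k, 2 * m = k + 4 := ⟨2 * m - 4, by omega⟩
  have e1 := choose_two_add_one k
  have e2 : (k + 2).choose 2 = k + 1 + (k + 1).choose 2 := choose_two_add_one _
  have e3 : (k + 3).choose 2 = k + 2 + (k + 2).choose 2 := choose_two_add_one _
  have e4 : (k + 4).choose 2 = k + 3 + (k + 3).choose 2 := choose_two_add_one _
  have hN : (2 * m).choose 2 = (k + 4).choose 2 := by rw [hk]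
  have hK : (2 * m - 4).choose 2 = k.choose 2 := by rw [hk, Nat.add_sub_cancel]
  simp only [Nat.succ_eq_add_one, Nat.reduceAdd] at h1 h2 h3
  omega

/-! ### Upper bound for the dimension of the minimal orbit. -/

theorem exists_form_ne_zero_of_notMem_span {v w : V m} (h : w ∉ Submodule.span ℂ {v}) :
    ∃ u, form m v u = 0 ∧ form m w u ≠ 0 := by
  obtain ⟨d, hd, hle⟩ := Submodule.exists_le_ker_of_notMem h
  obtain ⟨u, hu⟩ := exists_dual_eq_form d
  refine ⟨u, ?_, ?_⟩
  · rw [← hu]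
    exact hle (Submodule.mem_span_singleton_self v)
  · rwa [← hu]

theorem notMem_span_right {v w : V m} (h : LinearIndependent ℂ ![v, w]) :
    v ∉ Submodule.span ℂ {w} := by
  have := (linearIndependent_finCons.1 h).2
  rwa [Matrix.range_cons, Matrix.range_empty, Set.union_empty] at this

theorem notMem_span_left {v w : V m} (h : LinearIndependent ℂ ![v, w]) :
    w ∉ Submodule.span ℂ {v} :=
  notMem_span_right (LinearIndependent.pair_symm_iff.1 h)

/-- The linear map `(x, y) ↦ x ∧ f + e ∧ y`, with values in `so`. -/
def wedgeSum (e f : V m) : V m × V m →ₗ[ℂ] so m :=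
  phi m ∘ₗ ((wedgeBilin m).flip f).coprod (wedgeBilin m e)

theorem wedgeSum_apply (e f x y : V m) :
    wedgeSum e f (x, y) = phi m (wedge x f) + phi m (wedge e y) := by
  simp only [wedgeSum, LinearMap.comp_apply, LinearMap.coprod_apply, map_add]
  rfl

theorem phi_wedge_add_mulVec (x f e y u : V m) :
    (phi m (wedge x f) + phi m (wedge e y)).1.mulVec u =
      (form m x u • f - form m f u • x) + (form m e u • y - form m y u • e) := by
  rw [← phi_wedge_mulVec, ← phi_wedge_mulVec, ← Matrix.add_mulVec]
  rfl

/-- The functionals that cut out the pairs `(A e, A f)` with `A` in `so`. -/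
def pairConstraint (e f : V m) : V m × V m →ₗ[ℂ] Fin 3 → ℂ :=
  LinearMap.pi ![(form m e).coprod 0, (0 : V m →ₗ[ℂ] ℂ).coprod (form m f),
    (form m f).coprod (form m e)]

theorem pairConstraint_eq_zero_iff {e f x y : V m} :
    pairConstraint e f (x, y) = 0 ↔
      form m e x = 0 ∧ form m f y = 0 ∧ form m f x + form m e y = 0 := by
  rw [funext_iff, Fin.forall_fin_succ, Fin.forall_fin_two]
  simp [pairConstraint]

theorem range_pairConstraint {e f : V m} (h : LinearIndependent ℂ ![e, f]) :
    LinearMap.range (pairConstraint e f) = ⊤ := by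
  obtain ⟨a, hfa, hea⟩ := exists_form_ne_zero_of_notMem_span (notMem_span_right h)
  obtain ⟨b, heb, hfb⟩ := exists_form_ne_zero_of_notMem_span (notMem_span_left h)
  rw [eq_top_iff]
  intro z _
  -- Since `a ⟂ f` and `b ⟂ e`, each term affects a single coordinate.
  refine ⟨((z 0 / form m e a) • a + (z 2 / form m f b) • b, (z 1 / form m f b) • b), ?_⟩
  ext i
  fin_cases i <;> simp [pairConstraint, hfa, heb, hea, hfb]

theorem linearIndependent_pairs {e f : V m} (hi : LinearIndependent ℂ ![e, f]) :
    LinearIndependent ℂ ![((f, 0) : V m × V m), (0, e), (e, -f)] := by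
  refine Fintype.linearIndependent_iff.2 fun g hg => ?_
  simp only [Fin.sum_univ_three, Matrix.cons_val_zero, Matrix.cons_val_one, Matrix.cons_val,
    Prod.smul_mk, Prod.mk_add_mk, Prod.mk_eq_zero, smul_zero, add_zero, zero_add, smul_neg] at hg
  rw [LinearIndependent.pair_iff] at hi
  have a1 := hi (g 2) (g 0) (by rw [add_comm]; exact hg.1)
  have a2 := hi (g 1) (-g 2) (by rw [neg_smul]; exact hg.2)
  intro i
  fin_cases i
  exacts [a1.2, a2.1, a1.1]

theorem three_le_finrank_ker {e f : V m} (hef : IsotropicPair e f)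
    (hi : LinearIndependent ℂ ![e, f]) :
    3 ≤ finrank ℂ (LinearMap.ker (pairConstraint e f) ⊓ LinearMap.ker (wedgeSum e f) :
      Submodule ℂ (V m × V m)) := by
  obtain ⟨hee, hef, hff⟩ := hef
  have hfe : form m f e = 0 := by rw [form_comm, hef]
  have hle : Submodule.span ℂ (Set.range ![((f, 0) : V m × V m), (0, e), (e, -f)]) ≤
      LinearMap.ker (pairConstraint e f) ⊓ LinearMap.ker (wedgeSum e f) := by
    rw [Submodule.span_le]
    have key : ∀ x y : V m, form m e x = 0 → form m f y = 0 → form m f x + form m e y = 0 →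
        (∀ u, (form m x u • f - form m f u • x) + (form m e u • y - form m y u • e) = 0) →
        (x, y) ∈ LinearMap.ker (pairConstraint e f) ⊓ LinearMap.ker (wedgeSum e f) := by
      refine fun x y h1 h2 h3 h4 => ⟨pairConstraint_eq_zero_iff.2 ⟨h1, h2, h3⟩, ?_⟩
      rw [SetLike.mem_coe, LinearMap.mem_ker, wedgeSum_apply]
      refine so_ext fun u => ?_
      rw [phi_wedge_add_mulVec, h4, ZeroMemClass.coe_zero, Matrix.zero_mulVec]
    rintro _ ⟨i, rfl⟩
    fin_cases i
    · exact key f 0 hef (by simp) (by simp [hff]) (by simp)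
    · exact key 0 e (by simp) hfe (by simp [hee]) (by simp)
    · exact key e (-f) hee (by simp [hff]) (by simp [hfe, hef]) (fun u => by
        rw [map_neg, LinearMap.neg_apply]; module)
  have h := Submodule.finrank_mono hle
  rwa [finrank_span_eq_card (linearIndependent_pairs hi), Fintype.card_fin] at h

/-- The bracket of the image of `e ∧ f` with `A` is the image of `-(A e ∧ f + e ∧ A f)`. Skewness
puts `(A e, A f)` in a space of dimension `4m - 3`, on which `wedgeSum` has a kernel of dimension at
least 3, containing `(f, 0)`, `(0, e)` and `(e, -f)`. -/
theorem orbitDim_le_of_mem_isotropicCone {Y : so m} (hY : Y ∈ isotropicCone m)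
    (h0 : Y ≠ 0) : orbitDim m Y ≤ 4 * m - 6 := by
  obtain ⟨e, f, hef, rfl⟩ := hY
  have hi := linearIndependent_of_phi_ne_zero h0
  set K := LinearMap.ker (pairConstraint e f) with hK
  have h1 : LinearMap.range (LieAlgebra.ad ℂ (so m) (phi m (wedge e f)) : so m →ₗ[ℂ] so m) ≤
      K.map (wedgeSum e f) := by
    rintro _ ⟨A, rfl⟩
    refine ⟨(-A.1.mulVec e, -A.1.mulVec f), ?_, ?_⟩
    · rw [hK, SetLike.mem_coe, LinearMap.mem_ker, pairConstraint_eq_zero_iff]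
      simp only [map_neg, neg_eq_zero]
      refine ⟨?_, ?_, ?_⟩
      · rw [form_comm, form_mulVec_self]
      · rw [form_comm, form_mulVec_self]
      · rw [form_comm m e, form_mulVec_left A f, neg_neg, neg_add_cancel]
    · rw [wedgeSum_apply]
      refine so_ext fun u => ?_
      rw [phi_wedge_add_mulVec]
      have hbr : (LieAlgebra.ad ℂ (so m) (phi m (wedge e f)) A).1 =
          (phi m (wedge e f)).1 * A.1 - A.1 * (phi m (wedge e f)).1 := rfl
      rw [hbr, Matrix.sub_mulVec, ← Matrix.mulVec_mulVec, ← Matrix.mulVec_mulVec,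
        phi_wedge_mulVec, phi_wedge_mulVec, Matrix.mulVec_sub, Matrix.mulVec_smul,
        Matrix.mulVec_smul, map_neg, map_neg, LinearMap.neg_apply, LinearMap.neg_apply,
        form_mulVec_left, form_mulVec_left]
      module
  have h2 : finrank ℂ K + 3 = 4 * m := by
    have := LinearMap.finrank_range_add_finrank_ker (pairConstraint e f)
    rw [range_pairConstraint hi, finrank_top, Module.finrank_fin_fun, Module.finrank_prod,
      Module.finrank_fin_fun] at this
    change 3 + finrank ℂ K = _ at this
    omega
  have h3 := three_le_finrank_ker hef hi
  rw [← hK] at h3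
  have h4 := finrank_map_add_finrank_inf_ker (wedgeSum e f) K
  have h5 := Submodule.finrank_mono h1
  change orbitDim m _ ≤ _ at h5
  omega

/-! ### Witt's theorem and transitivity on the nonzero cone. -/

/-- The matrix `g` preserves the form. -/
def IsIsometry (g : Matrix (Fin (2 * m)) (Fin (2 * m)) ℂ) : Prop :=
  ∀ x y : V m, form m (g.mulVec x) (g.mulVec y) = form m x y

theorem isIsometry_iff (g : Matrix (Fin (2 * m)) (Fin (2 * m)) ℂ) :
    IsIsometry g ↔ g.transpose * J m * g = J m := by
  have h : (form m).comp (Matrix.toLin' g) (Matrix.toLin' g) =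
      Matrix.toBilin' (g.transpose * J m * g) := Matrix.toBilin'_comp _ _ _
  rw [← (Matrix.toBilin' (R₁ := ℂ) (n := Fin (2 * m))).injective.eq_iff, ← h]
  constructor
  · exact fun hg => LinearMap.ext₂ hg
  · intro hg x y
    exact LinearMap.congr_fun₂ hg x y

theorem IsIsometry.mul {g h : Matrix (Fin (2 * m)) (Fin (2 * m)) ℂ} (hg : IsIsometry g)
    (hh : IsIsometry h) : IsIsometry (g * h) := fun x y => by
  rw [← Matrix.mulVec_mulVec, ← Matrix.mulVec_mulVec, hg, hh]

theorem det_J_ne_zero (m : ℕ) : (J m).det ≠ 0 := by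
  have h : J m * J m = 1 := by
    ext i j
    simp [J, Matrix.mul_apply, Matrix.one_apply]
  intro h0
  have := congrArg Matrix.det h
  rw [Matrix.det_mul, h0, Matrix.det_one] at this
  simp at this

theorem IsIsometry.det_eq {g : Matrix (Fin (2 * m)) (Fin (2 * m)) ℂ} (hg : IsIsometry g) :
    g.det = 1 ∨ g.det = -1 := by
  have := congrArg Matrix.det ((isIsometry_iff g).1 hg)
  rw [Matrix.det_mul, Matrix.det_mul, Matrix.det_transpose] at this
  rw [← mul_self_eq_one_iff]
  apply mul_right_cancel₀ (det_J_ne_zero m)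
  linear_combination this

/-- The reflection in the hyperplane orthogonal to `u`. -/
def reflectionMatrix (u : V m) : Matrix (Fin (2 * m)) (Fin (2 * m)) ℂ :=
  1 + Matrix.vecMulVec ((-2 / form m u u) • u) (fun i => u (Fin.rev i))

theorem reflectionMatrix_mulVec (u x : V m) :
    (reflectionMatrix u).mulVec x = x - (2 * form m u x / form m u u) • u := by
  have h : (fun i => u (Fin.rev i)) ⬝ᵥ x = form m u x := (form_apply m u x).symm
  rw [reflectionMatrix, Matrix.add_mulVec, Matrix.one_mulVec, Matrix.vecMulVec_mulVec, h]
  ext i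
  simp
  ring

theorem isIsometry_reflectionMatrix {u : V m} (hu : form m u u ≠ 0) :
    IsIsometry (reflectionMatrix u) := fun x y => by
  simp only [reflectionMatrix_mulVec, map_sub, map_smul, LinearMap.sub_apply,
    LinearMap.smul_apply, smul_eq_mul, form_comm m x u]
  field_simp
  ring

theorem det_reflectionMatrix {u : V m} (hu : form m u u ≠ 0) :
    (reflectionMatrix u).det = -1 := by
  have h : (fun i => u (Fin.rev i)) ⬝ᵥ u = form m u u := (form_apply m u u).symm
  rw [reflectionMatrix, Matrix.vecMulVec_eq Unit, Matrix.det_one_add_replicateCol_mul_replicateRow,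
    dotProduct_smul, h, smul_eq_mul, div_mul_cancel₀ _ hu]
  norm_num

/-- The reflection in `w - w'`, which is anisotropic because `(w - w', w - w') = -2 (w, w')`. -/
theorem exists_isIsometry_of_form_ne_zero {v w w' : V m} (hw : form m w w = 0)
    (hw' : form m w' w' = 0) (hvw : form m v w = 0) (hvw' : form m v w' = 0)
    (h : form m w w' ≠ 0) :
    ∃ g : Matrix (Fin (2 * m)) (Fin (2 * m)) ℂ, IsIsometry g ∧ g.mulVec v = v ∧
      g.mulVec w = w' := by
  have h1 : form m (w - w') (w - w') = -2 * form m w w' := by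
    simp only [map_sub, LinearMap.sub_apply, hw, hw', form_comm m w' w]
    ring
  have h0 : form m (w - w') (w - w') ≠ 0 := by
    rw [h1]
    exact mul_ne_zero (by norm_num) h
  refine ⟨reflectionMatrix (w - w'), isIsometry_reflectionMatrix h0, ?_, ?_⟩
  · rw [reflectionMatrix_mulVec, form_comm, map_sub, hvw, hvw']
    simp
  · have h2 : form m (w - w') w = - form m w w' := by
      simp only [map_sub, LinearMap.sub_apply, hw, form_comm m w' w]
      ring
    rw [reflectionMatrix_mulVec, h1, h2]
    have : 2 * -form m w w' / (-2 * form m w w') = 1 := by field_simp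
    rw [this, one_smul, sub_sub_cancel]

/-- Two isotropic vectors orthogonal to `v` and not proportional to `v` are related by an
isometry that fixes `v`. -/
theorem exists_isIsometry_fixing {v w w' : V m} (hw : form m w w = 0)
    (hw' : form m w' w' = 0) (hvw : form m v w = 0) (hvw' : form m v w' = 0)
    (hs : w ∉ Submodule.span ℂ {v}) (hs' : w' ∉ Submodule.span ℂ {v}) :
    ∃ g : Matrix (Fin (2 * m)) (Fin (2 * m)) ℂ, IsIsometry g ∧ g.mulVec v = v ∧
      g.mulVec w = w' := by
  by_cases h : form m w w' = 0
  swap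
  · exact exists_isIsometry_of_form_ne_zero hw hw' hvw hvw' h
  obtain ⟨u, hu, hwu⟩ := exists_form_ne_zero_of_notMem_span hs
  obtain ⟨u', hu', hwu'⟩ := exists_form_ne_zero_of_notMem_span hs'
  -- When `(w, w') = 0`, two reflections are composed through an intermediate isotropic `z`
  -- orthogonal to `v` and to neither `w` nor `w'`. It is `x` corrected by a multiple of `w`, which
  -- changes none of these pairings.
  obtain ⟨x, hvx, hwx, hwx'⟩ : ∃ x, form m v x = 0 ∧ form m w x ≠ 0 ∧ form m w' x ≠ 0 := by
    by_cases h1 : form m w' u = 0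
    · by_cases h2 : form m w u' = 0
      · exact ⟨u + u', by simp [hu, hu'], by simpa [h2] using hwu, by simpa [h1] using hwu'⟩
      · exact ⟨u', hu', h2, hwu'⟩
    · exact ⟨u, hu, hwu, h1⟩
  set z := x - (form m x x / (2 * form m w x)) • w with hz
  have hvz : form m v z = 0 := by simp [hz, hvx, hvw]
  have hwz : form m w z = form m w x := by simp [hz, hw]
  have hwz' : form m w' z = form m w' x := by simp [hz, form_comm m w' w, h]
  have hzz : form m z z = 0 := by
    simp only [hz, map_sub, map_smul, LinearMap.sub_apply, LinearMap.smul_apply, smul_eq_mul, hw,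
      form_comm m x w]
    field_simp
    ring
  obtain ⟨g, hg, hgv, hgw⟩ := exists_isIsometry_of_form_ne_zero hw hzz hvw hvz (hwz ▸ hwx)
  obtain ⟨g', hg', hgv', hgw'⟩ := exists_isIsometry_of_form_ne_zero hzz hw' hvz hvw'
    (by rw [form_comm, hwz']; exact hwx')
  exact ⟨g' * g, hg'.mul hg, by rw [← Matrix.mulVec_mulVec, hgv, hgv'],
    by rw [← Matrix.mulVec_mulVec, hgw, hgw']⟩

theorem IsIsometry.injective {g : Matrix (Fin (2 * m)) (Fin (2 * m)) ℂ} (hg : IsIsometry g) :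
    Function.Injective (Matrix.toLin' g) := by
  rw [← LinearMap.ker_eq_bot, LinearMap.ker_eq_bot']
  intro x hx
  rw [Matrix.toLin'_apply] at hx
  refine eq_zero_of_form_eq_zero fun y => ?_
  rw [← hg, hx, map_zero, LinearMap.zero_apply]

theorem IsIsometry.linearIndependent_pair {g : Matrix (Fin (2 * m)) (Fin (2 * m)) ℂ}
    (hg : IsIsometry g) {v w : V m} (h : LinearIndependent ℂ ![v, w]) :
    LinearIndependent ℂ ![g.mulVec v, g.mulVec w] := by
  have h1 := h.map' (Matrix.toLin' g) (LinearMap.ker_eq_bot.2 hg.injective)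
  have h2 : Matrix.toLin' g ∘ ![v, w] = ![g.mulVec v, g.mulVec w] := by
    ext i : 1
    fin_cases i <;> simp
  rw [h2] at h1
  exact h1

theorem IsIsometry.isotropicPair {g : Matrix (Fin (2 * m)) (Fin (2 * m)) ℂ}
    (hg : IsIsometry g) {v w : V m} (h : IsotropicPair v w) :
    IsotropicPair (g.mulVec v) (g.mulVec w) := by
  simpa only [IsotropicPair, hg _ _] using h

/-- Witt's theorem for isotropic planes. -/
theorem exists_isIsometry_of_isotropicPair {v w v' w' : V m} (h : IsotropicPair v w)
    (h' : IsotropicPair v' w') (hi : LinearIndependent ℂ ![v, w])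
    (hi' : LinearIndependent ℂ ![v', w']) :
    ∃ g : Matrix (Fin (2 * m)) (Fin (2 * m)) ℂ, IsIsometry g ∧ g.mulVec v = v' ∧
      g.mulVec w = w' := by
  -- Fixing the zero vector is no condition, so this step moves `v` to `v'`; the next one fixes
  -- `v'`.
  obtain ⟨g, hg, -, hgv⟩ := exists_isIsometry_fixing (v := 0) h.1 h'.1 (by simp) (by simp)
    (by simpa using hi.ne_zero 0) (by simpa using hi'.ne_zero 0)
  have h1 := hg.isotropicPair h
  have h2 := hg.linearIndependent_pair hi
  rw [hgv] at h1 h2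
  obtain ⟨g', hg', hgv', hgw'⟩ := exists_isIsometry_fixing h1.2.2 h'.2.2 h1.2.1 h'.2.1
    (notMem_span_left h2) (notMem_span_left hi')
  exact ⟨g' * g, hg'.mul hg, by rw [← Matrix.mulVec_mulVec, hgv, hgv'],
    by rw [← Matrix.mulVec_mulVec, hgw']⟩

/-- Otherwise, by polarization, the complement of the plane, of dimension `2m - 2`, would lie in its
own orthogonal, of dimension 2. -/
theorem exists_anisotropic_orthogonal (hm : 4 ≤ m) {v w : V m}
    (hi : LinearIndependent ℂ ![v, w]) :
    ∃ u, form m u v = 0 ∧ form m u w = 0 ∧ form m u u ≠ 0 := by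
  by_contra! hc
  set P := (form m).orthogonal (Submodule.span ℂ (Set.range ![v, w])) with hP
  have hmem : ∀ x ∈ P, form m x v = 0 ∧ form m x w = 0 := fun x hx => by
    rw [LinearMap.BilinForm.mem_orthogonal_iff] at hx
    rw [form_comm m x v, form_comm m x w]
    exact ⟨hx v (Submodule.subset_span ⟨0, rfl⟩), hx w (Submodule.subset_span ⟨1, rfl⟩)⟩
  have hself : ∀ x ∈ P, form m x x = 0 := fun x hx => hc x (hmem x hx).1 (hmem x hx).2
  have hle : P ≤ (form m).orthogonal P := by
    intro x hx
    rw [LinearMap.BilinForm.mem_orthogonal_iff]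
    intro y hy
    have h1 := hself _ (add_mem hx hy)
    simp only [map_add, LinearMap.add_apply, hself x hx, hself y hy, form_comm m x y] at h1
    change form m y x = 0
    linear_combination h1 / 2
  have h1 := Submodule.finrank_mono hle
  have h2 : finrank ℂ P = 2 * m - 2 := by
    rw [hP, LinearMap.BilinForm.finrank_orthogonal (form_nondegenerate m), finrank_span_eq_card hi,
      Module.finrank_fin_fun, Fintype.card_fin]
  rw [LinearMap.BilinForm.finrank_orthogonal (form_nondegenerate m) P, h2,
    Module.finrank_fin_fun] at h1
  omega

/-- An isometry of determinant `-1` is corrected by a reflection that fixes `v'` and `w'`. -/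
theorem exists_mem_SO_of_isotropicPair (hm : 4 ≤ m) {v w v' w' : V m} (h : IsotropicPair v w)
    (h' : IsotropicPair v' w') (hi : LinearIndependent ℂ ![v, w])
    (hi' : LinearIndependent ℂ ![v', w']) :
    ∃ g ∈ SO m, g.1.mulVec v = v' ∧ g.1.mulVec w = w' := by
  obtain ⟨g, hg, hgv, hgw⟩ := exists_isIsometry_of_isotropicPair h h' hi hi'
  rcases hg.det_eq with hd | hd
  · exact ⟨⟨g, hd⟩, (isIsometry_iff g).1 hg, hgv, hgw⟩
  · obtain ⟨u, huv, huw, huu⟩ := exists_anisotropic_orthogonal hm hi'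
    refine ⟨⟨reflectionMatrix u * g, ?_⟩,
      (isIsometry_iff _).1 ((isIsometry_reflectionMatrix huu).mul hg), ?_, ?_⟩
    · rw [Matrix.det_mul, det_reflectionMatrix huu, hd]
      norm_num
    · change (reflectionMatrix u * g).mulVec v = v'
      rw [← Matrix.mulVec_mulVec, hgv, reflectionMatrix_mulVec, huv]
      simp
    · change (reflectionMatrix u * g).mulVec w = w'
      rw [← Matrix.mulVec_mulVec, hgw, reflectionMatrix_mulVec, huw]
      simp

theorem conj_phi_wedge {g : Matrix.SpecialLinearGroup (Fin (2 * m)) ℂ} (hg : g ∈ SO m)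
    (v w : V m) : g.1 * (phi m (wedge v w)).1 * (g⁻¹).1 =
      (phi m (wedge (g.1.mulVec v) (g.1.mulVec w))).1 := by
  have hiso : IsIsometry g.1 := (isIsometry_iff _).2 hg
  have hinv : ∀ u : V m, g.1.mulVec ((g⁻¹).1.mulVec u) = u := fun u => by
    rw [Matrix.mulVec_mulVec, ← Matrix.SpecialLinearGroup.coe_mul]
    simp
  apply Matrix.ext_of_mulVec_single
  intro i
  generalize (Pi.single i 1 : V m) = u
  rw [phi_wedge_mulVec, ← Matrix.mulVec_mulVec, ← Matrix.mulVec_mulVec, phi_wedge_mulVec]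
  conv_rhs => rw [← hinv u, hiso, hiso]
  rw [Matrix.mulVec_sub, Matrix.mulVec_smul, Matrix.mulVec_smul]

theorem phi_wedge_ne_zero {v w : V m} (hi : LinearIndependent ℂ ![v, w]) :
    phi m (wedge v w) ≠ 0 := by
  intro h
  obtain ⟨u, hu, hu'⟩ := exists_form_ne_zero_of_notMem_span (notMem_span_left hi)
  have h1 := phi_wedge_mulVec m v w u
  rw [h, hu] at h1
  have h2 : v = 0 := by simpa [hu'] using h1
  exact hi.ne_zero 0 h2

theorem adjointOrbit_eq (hm : 4 ≤ m) {X : so m} (hX : X ∈ isotropicCone m) (h0 : X ≠ 0) :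
    adjointOrbit m X = isotropicCone m \ {0} := by
  obtain ⟨v, w, hvw, rfl⟩ := hX
  have hi := linearIndependent_of_phi_ne_zero h0
  ext Y
  constructor
  · rintro ⟨g, hg, hY⟩
    rw [conj_phi_wedge hg] at hY
    have hiso : IsIsometry g.1 := (isIsometry_iff _).2 hg
    have hY' := Subtype.ext hY
    rw [hY']
    exact ⟨⟨_, _, hiso.isotropicPair hvw, rfl⟩,
      phi_wedge_ne_zero (hiso.linearIndependent_pair hi)⟩
  · rintro ⟨⟨v', w', hvw', rfl⟩, hY0⟩
    have hi' := linearIndependent_of_phi_ne_zero hY0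
    obtain ⟨g, hg, hgv, hgw⟩ := exists_mem_SO_of_isotropicPair hm hvw hvw' hi hi'
    refine ⟨g, hg, ?_⟩
    rw [conj_phi_wedge hg, hgv, hgw]

/-! ### Equations of the cone and the two closures. -/

/-- The first family of quadrics says `Y² = 0`. The second is the Plücker relation for the
alternating form `(Y a, b)`; where `(Y a, b) = 1` it expresses `Y u` through `Y a` and `Y b`. -/
theorem mem_isotropicCone_iff (Y : so m) : Y ∈ isotropicCone m ↔
    (∀ a b, form m (Y.1.mulVec a) (Y.1.mulVec b) = 0) ∧
    ∀ a b c u, form m (Y.1.mulVec a) b * form m (Y.1.mulVec u) c =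
      form m (Y.1.mulVec a) u * form m (Y.1.mulVec b) c -
        form m (Y.1.mulVec b) u * form m (Y.1.mulVec a) c := by
  constructor
  · rintro ⟨v, w, hvw, rfl⟩
    refine ⟨fun a b => (isotropicPair_mulVec (mulVec_mulVec_phi hvw) a b).2.1, fun a b c u => ?_⟩
    simp only [phi_wedge_mulVec, map_sub, map_smul, LinearMap.sub_apply, LinearMap.smul_apply,
      smul_eq_mul]
    ring
  · rintro ⟨h1, h2⟩
    by_cases h0 : Y = 0
    · refine ⟨0, 0, by simp [IsotropicPair], ?_⟩
      rw [h0, wedge_eq_zero_of_dependent fun h => h.ne_zero 0 rfl, map_zero]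
    obtain ⟨a, b, hab⟩ := exists_form_mulVec_eq_one h0
    have hsq : ∀ u, Y.1.mulVec (Y.1.mulVec u) = 0 := fun u => eq_zero_of_form_eq_zero fun x => by
      rw [form_mulVec_left, h1, neg_zero]
    refine ⟨_, _, isotropicPair_mulVec hsq a b, eq_phi_of_mem_span hab fun u => ?_⟩
    have hu : Y.1.mulVec u = form m (Y.1.mulVec a) u • Y.1.mulVec b -
        form m (Y.1.mulVec b) u • Y.1.mulVec a := by
      rw [← sub_eq_zero]
      refine eq_zero_of_form_eq_zero fun c => ?_
      have := h2 a b c u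
      rw [hab, one_mul] at this
      simp only [map_sub, map_smul, LinearMap.sub_apply, LinearMap.smul_apply, smul_eq_mul, this,
        sub_self]
    rw [hu]
    exact sub_mem (Submodule.smul_mem _ _ (Submodule.subset_span (by simp)))
      (Submodule.smul_mem _ _ (Submodule.subset_span (by simp)))

theorem zariskiClosure_mono {W : Type*} [AddCommGroup W] [Module ℂ W] {S T : Set W}
    (h : S ⊆ T) : zariskiClosure S ⊆ zariskiClosure T :=
  fun _ hx p hp => hx p fun y hy => hp y (h hy)

/-- The matrix coefficient `A ↦ (A a, b)`. -/
def matrixCoeff (a b : V m) : Dual ℂ (so m) := (form m).flip b ∘ₗ evalAt a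

theorem matrixCoeff_apply (a b : V m) (A : so m) :
    matrixCoeff a b A = form m (A.1.mulVec a) b := rfl

theorem zariskiClosure_isotropicCone (m : ℕ) :
    zariskiClosure (isotropicCone m) ⊆ isotropicCone m := by
  intro A hA
  rw [mem_isotropicCone_iff]
  have hsum : ∀ (B : so m) (a b : V m), form m (B.1.mulVec a) (B.1.mulVec b) =
      ∑ i, matrixCoeff a (Pi.single i 1) B * matrixCoeff b (Pi.single (Fin.rev i) 1) B := by
    intro B a b
    rw [form_apply]
    simp only [matrixCoeff_apply, form_single_right, Fin.rev_rev]
  constructor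
  · intro a b
    have := hA (∑ i, MvPolynomial.X (matrixCoeff a (Pi.single i 1)) *
      MvPolynomial.X (matrixCoeff b (Pi.single (Fin.rev i) 1))) (fun B hB => by
        simp only [map_sum, map_mul, MvPolynomial.eval_X]
        rw [← hsum]
        exact ((mem_isotropicCone_iff B).1 hB).1 a b)
    simp only [map_sum, map_mul, MvPolynomial.eval_X] at this
    rwa [← hsum] at this
  · intro a b c u
    have := hA (MvPolynomial.X (matrixCoeff a b) * MvPolynomial.X (matrixCoeff u c) -
      (MvPolynomial.X (matrixCoeff a u) * MvPolynomial.X (matrixCoeff b c) -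
        MvPolynomial.X (matrixCoeff b u) * MvPolynomial.X (matrixCoeff a c))) (fun B hB => by
          simp only [map_sub, map_mul, MvPolynomial.eval_X, matrixCoeff_apply]
          exact sub_eq_zero.2 (((mem_isotropicCone_iff B).1 hB).2 a b c u))
    simp only [map_sub, map_mul, MvPolynomial.eval_X, matrixCoeff_apply] at this
    exact sub_eq_zero.1 this

/-- The topology on `so m` is induced from matrices, and `l` extends to a functional on all
matrices. -/
theorem continuous_dual_so (l : Dual ℂ (so m)) : Continuous l := by
  obtain ⟨l', hl'⟩ := LinearMap.exists_extend (p := (so m).toSubmodule) l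
  have h : (l : so m → ℂ) = l' ∘ Subtype.val := by
    rw [← hl']; rfl
  rw [h]
  exact (LinearMap.continuous_of_finiteDimensional l').comp continuous_subtype_val

theorem closure_subset_zariskiClosure (S : Set (so m)) : closure S ⊆ zariskiClosure S := by
  intro x hx p hp
  have hc : Continuous fun y : so m => MvPolynomial.eval (fun l : Dual ℂ (so m) => l y) p :=
    (MvPolynomial.continuous_eval p).comp (continuous_pi continuous_dual_so)
  exact closure_minimal (t := {y | MvPolynomial.eval (fun l : Dual ℂ (so m) => l y) p = 0}) hp
    (isClosed_singleton.preimage hc) hx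

theorem smul_mem_isotropicCone {A : so m} (hA : A ∈ isotropicCone m) (c : ℂ) :
    c • A ∈ isotropicCone m := by
  obtain ⟨v, w, ⟨h1, h2, h3⟩, rfl⟩ := hA
  refine ⟨c • v, w, ⟨by simp [h1], by simp [h2], h3⟩, ?_⟩
  rw [← map_smul]
  congr 1
  exact ((wedgeBilin m).map_smul₂ c v w).symm

theorem exists_mem_isotropicCone_ne_zero (hm : 4 ≤ m) : ∃ A ∈ isotropicCone m, A ≠ 0 := by
  let i : Fin (2 * m) := ⟨0, by omega⟩
  let j : Fin (2 * m) := ⟨1, by omega⟩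
  have hij : i ≠ j := by simp [i, j]
  -- With indices starting at 0, basis vectors pair nontrivially only when the indices sum to `2m -
  -- 1`.
  have h : ∀ a b : Fin (2 * m), a.1 + b.1 + 1 ≠ 2 * m →
      form m (Pi.single a 1) (Pi.single b 1) = 0 := fun a b hab => by
    rw [form_single_right, Pi.single_eq_of_ne]
    intro he
    have := congrArg Fin.val he
    rw [Fin.val_rev] at this
    omega
  refine ⟨_, ⟨Pi.single i 1, Pi.single j 1, ⟨h _ _ ?_, h _ _ ?_, h _ _ ?_⟩, rfl⟩,
    phi_wedge_ne_zero ?_⟩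
  · simp [i]; omega
  · simp [i, j]; omega
  · simp [j]; omega
  · rw [LinearIndependent.pair_iff]
    intro s t hst
    have hi := congrFun hst i
    have hj := congrFun hst j
    exact ⟨by simpa [hij] using hi, by simpa [hij.symm] using hj⟩

theorem zero_mem_closure (hm : 4 ≤ m) : (0 : so m) ∈ closure (isotropicCone m \ {0}) := by
  obtain ⟨A, hA, h0⟩ := exists_mem_isotropicCone_ne_zero hm
  have ht : Filter.Tendsto (fun n : ℕ => (1 / ((n : ℂ) + 1)) • A) Filter.atTop (nhds 0) := by
    rw [tendsto_subtype_rng]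
    have h1 : Filter.Tendsto (fun n : ℕ => (1 / ((n : ℂ) + 1)) • A.1) Filter.atTop
        (nhds ((0 : ℂ) • A.1)) := (tendsto_one_div_add_atTop_nhds_zero_nat (𝕜 := ℂ)).smul_const _
    rw [zero_smul] at h1
    exact h1
  refine mem_closure_of_tendsto ht (Filter.Eventually.of_forall fun n => ?_)
  refine ⟨smul_mem_isotropicCone hA _, ?_⟩
  exact smul_ne_zero (one_div_ne_zero (Nat.cast_add_one_ne_zero n)) h0

theorem isotropicCone_subset_closure (hm : 4 ≤ m) :
    isotropicCone m ⊆ closure (isotropicCone m \ {0}) := by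
  intro A hA
  by_cases h : A = 0
  · rw [h]; exact zero_mem_closure hm
  · exact subset_closure ⟨hA, h⟩

theorem zariskiClosure_isotropicCone_diff (hm : 4 ≤ m) :
    zariskiClosure (isotropicCone m \ {0}) = isotropicCone m :=
  ((zariskiClosure_mono Set.sdiff_subset).trans (zariskiClosure_isotropicCone m)).antisymm
    ((isotropicCone_subset_closure hm).trans (closure_subset_zariskiClosure _))

theorem closure_isotropicCone_diff (hm : 4 ≤ m) :
    closure (isotropicCone m \ {0}) = isotropicCone m :=
  ((closure_subset_zariskiClosure _).trans (zariskiClosure_isotropicCone_diff hm).subset).antisymm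
    (isotropicCone_subset_closure hm)

/-! ### Identification of the minimal orbit. -/

theorem isNilpotent_of_mem_isotropicCone {A : so m} (hA : A ∈ isotropicCone m) :
    IsNilpotent A.1 := by
  obtain ⟨v, w, hvw, rfl⟩ := hA
  refine ⟨2, Matrix.ext_of_mulVec_single fun i => ?_⟩
  rw [pow_two, ← Matrix.mulVec_mulVec, mulVec_mulVec_phi hvw, Matrix.zero_mulVec]

theorem ne_zero_of_orbitDim_pos {Y : so m} (h : 0 < orbitDim m Y) : Y ≠ 0 := by
  rintro rfl
  have h1 : LieAlgebra.ad ℂ (so m) 0 = 0 := map_zero _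
  rw [orbitDim, h1, LinearMap.range_zero, finrank_bot] at h
  exact h.false

theorem isMinimalNilpotentOrbit_iff (hm : 4 ≤ m) (O : Set (so m)) :
    IsMinimalNilpotentOrbit m O ↔ O = isotropicCone m \ {0} := by
  obtain ⟨A, hA, hA0⟩ := exists_mem_isotropicCone_ne_zero hm
  have h1 := orbitDim_le_of_mem_isotropicCone hA hA0
  have h2 := le_orbitDim_of_mem_isotropicCone hm hA hA0
  have hnil := isNilpotent_of_mem_isotropicCone hA
  constructor
  · rintro ⟨X, rfl, hX, hpos, hmin⟩
    have h3 := hmin A hnil (by omega)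
    refine adjointOrbit_eq hm ?_ (ne_zero_of_orbitDim_pos hpos)
    by_contra hc
    have := lt_orbitDim_of_notMem_isotropicCone hm hX hc
    omega
  · rintro rfl
    refine ⟨A, (adjointOrbit_eq hm hA hA0).symm, hnil, by omega, fun Y hY hpos => h1.trans ?_⟩
    by_cases hc : Y ∈ isotropicCone m
    · exact le_orbitDim_of_mem_isotropicCone hm hc (ne_zero_of_orbitDim_pos hpos)
    · exact (lt_orbitDim_of_notMem_isotropicCone hm hY hc).le

end MinOrbit

end

theorem mainTheorem10 (m : ℕ) (hm : 4 ≤ m) :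
    (∃! O : Set (MinOrbit.so m), MinOrbit.IsMinimalNilpotentOrbit m O) ∧
    ∀ O : Set (MinOrbit.so m), MinOrbit.IsMinimalNilpotentOrbit m O →
      MinOrbit.bivectorEquivSo m ⁻¹' MinOrbit.zariskiClosure O =
        {α | MinOrbit.IsDecomposable α ∧ MinOrbit.IsIsotropic α} ∧
      MinOrbit.bivectorEquivSo m ⁻¹' closure O =
        {α | MinOrbit.IsDecomposable α ∧ MinOrbit.IsIsotropic α} := by
  have h : MinOrbit.bivectorEquivSo m ⁻¹' MinOrbit.isotropicCone m =
      {α | MinOrbit.IsDecomposable α ∧ MinOrbit.IsIsotropic α} :=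
    Set.ext fun α => (MinOrbit.isDecomposable_and_isIsotropic_iff α).symm
  refine ⟨⟨_, (MinOrbit.isMinimalNilpotentOrbit_iff hm _).2 rfl,
    fun O hO => (MinOrbit.isMinimalNilpotentOrbit_iff hm O).1 hO⟩, fun O hO => ?_⟩
  rw [(MinOrbit.isMinimalNilpotentOrbit_iff hm O).1 hO,
    MinOrbit.zariskiClosure_isotropicCone_diff hm, MinOrbit.closure_isotropicCone_diff hm]
  exact ⟨h, h⟩
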